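/- A coherent category is a category with finite limits, pullback-stable image factorizations and pullback-stable finite unions of subobjects; a functor between such categories is coherent if it preserves finite limits, effective epimorphisms (equivalently, images) and finite unions of subobjects. A natural transformation $\eta : N\Rightarrow M$ between coherent functors $\mathcal{C}\to \mathcal{E}$ is elementary if for every monomorphism $i:a\hookrightarrow x$ of $\mathcal{C}$ the naturality square of $\eta$ at $i$ is a pullback. $\mathbf{Coh}_e(\mathcal{C},\mathbf{Set})$ is the category of coherent functors $\mathcal{C}\to\mathbf{Set}$ and elementary natural transformations. A small coherent category $\mathcal{C}$ is semantically complete if it is not equivalent to the terminal category $*$ and for any two coherent functors $M,N:\mathcal{C}\to\mathbf{Set}$ and any subobjects $a\hookrightarrow x\hookleftarrow b$ in $\mathcal{C}$ we have $Ma\subseteq Mb$ if and only if $Na\subseteq Nb$. $\mathcal{C}$ is Boolean if every subobject in $\mathcal{C}$ has a complement. A category has the joint embedding property if any two of its objects admit morphisms to a common object. Theorem. Let $\mathcal{C}$ be a small coherent category. (1) If $\mathcal{C}$ is semantically complete, then $\mathbf{Coh}_e(\mathcal{C},\mathbf{Set})$ has the joint embedding property. (2) Conversely, if $\mathcal{C}$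 is Boolean, $\mathcal{C}\not\simeq *$, and $\mathbf{Coh}_e(\mathcal{C},\mathbf{Set})$ has the joint embedding property, then $\mathcal{C}$ is semantically complete. -/

import Mathlib

open CategoryTheory CategoryTheory.Limits

universe u

namespace CohLogic

universe v₁ v₂ v₃ u₁ u₂ u₃

/-- A coherent category: a regular category (finite limits and pullback-stable image
factorizations) in which every poset of subobjects has finite joins (a least element and binary
joins), and these are preserved by pulling back along any morphism. -/
class CoherentCategory (C : Type u₁) [Category.{v₁} C] : Prop extends Regular C where
  exists_isBot (x : C) : ∃ b : Subobject x, IsBot b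
  exists_isLUB {x : C} (a b : Subobject x) : ∃ c : Subobject x, IsLUB {a, b} c
  isBot_pullback {x y : C} (f : x ⟶ y) {b : Subobject y} :
    IsBot b → IsBot ((Subobject.pullback f).obj b)
  isLUB_pullback {x y : C} (f : x ⟶ y) {a b c : Subobject y} :
    IsLUB {a, b} c →
      IsLUB {(Subobject.pullback f).obj a, (Subobject.pullback f).obj b}
        ((Subobject.pullback f).obj c)

/-- A coherent category is Boolean if every subobject has a complement, i.e. all the
(distributive) lattices of subobjects are Boolean algebras. -/
def IsBoolean (C : Type u₁) [Category.{v₁} C] [CoherentCategory C] : Prop :=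
  ∀ (x : C) (a : Subobject x), ∃ b : Subobject x, IsBot (a ⊓ b) ∧ IsLUB {a, b} ⊤

/-- A category is trivial if it is equivalent to the terminal category `*`. -/
def IsTrivialCategory (C : Type u₁) [Category.{v₁} C] : Prop :=
  Nonempty (C ≌ Discrete PUnit.{1})

section Functors

variable {C : Type u₁} [Category.{v₁} C] {D : Type u₂} [Category.{v₂} D]

/-- The action `a ↦ M a` on subobjects of a functor that preserves finite limits (and hence
monomorphisms). -/
noncomputable def mapSub (M : C ⥤ D) [PreservesFiniteLimits M] {x : C} (a : Subobject x) :
    Subobject (M.obj x) :=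
  Subobject.mk (M.map a.arrow)

/-- A coherent functor preserves finite limits, effective epimorphisms (hence images) and finite
unions of subobjects. -/
class IsCoherentFunctor (M : C ⥤ D) : Prop extends PreservesFiniteLimits M where
  isRegularEpi_map {x y : C} (f : x ⟶ y) : IsRegularEpi f → IsRegularEpi (M.map f)
  isBot_mapSub {x : C} {b : Subobject x} : IsBot b → IsBot (mapSub M b)
  isLUB_mapSub {x : C} {a b c : Subobject x} :
    IsLUB {a, b} c → IsLUB {mapSub M a, mapSub M b} (mapSub M c)

/-- A natural transformation is elementary if its naturality squares at monomorphisms are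
pullback squares. -/
def IsElementary {N M : C ⥤ D} (η : N ⟶ M) : Prop :=
  ∀ ⦃a x : C⦄ (i : a ⟶ x) [Mono i], IsPullback (N.map i) (η.app a) (η.app x) (M.map i)

theorem IsElementary.id (M : C ⥤ D) : IsElementary (𝟙 M) := by
  intro a x i _
  exact IsPullback.of_vert_isIso ⟨by simp⟩

theorem IsElementary.comp {M N K : C ⥤ D} {η : M ⟶ N} {θ : N ⟶ K} (hη : IsElementary η)
    (hθ : IsElementary θ) : IsElementary (η ≫ θ) := by
  intro a x i _
  simpa using (hη i).paste_vert (hθ i)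

/-- Two coherent functors are elementary equivalent if for all subobjects `a, b` of an object of
`C` we have `M a ≤ M b` iff `N a ≤ N b`. -/
def ElementaryEquivalent (M N : C ⥤ D) [IsCoherentFunctor M] [IsCoherentFunctor N] : Prop :=
  ∀ ⦃x : C⦄ (a b : Subobject x), mapSub M a ≤ mapSub M b ↔ mapSub N a ≤ mapSub N b

end Functors

/-- The objects of the category of coherent functors and elementary natural transformations. -/
structure CohE (C : Type u₁) [Category.{v₁} C] (D : Type u₂) [Category.{v₂} D] where
  functor : C ⥤ D
  [isCoherent : IsCoherentFunctor functor]

attribute [instance] CohE.isCoherent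

/-- The category of coherent functors and elementary natural transformations. -/
instance (C : Type u₁) [Category.{v₁} C] (D : Type u₂) [Category.{v₂} D] :
    Category (CohE C D) where
  Hom M N := {η : M.functor ⟶ N.functor // IsElementary η}
  id M := ⟨𝟙 M.functor, IsElementary.id M.functor⟩
  comp η θ := ⟨η.1 ≫ θ.1, η.2.comp θ.2⟩

/-- A small coherent category that is not equivalent to `*` is semantically complete if any two
coherent functors from it to sets are elementary equivalent. -/
def SemanticallyComplete (C : Type u) [SmallCategory C] [CoherentCategory C] : Prop :=
  ¬ IsTrivialCategory C ∧
    ∀ (M N : C ⥤ Type u) [IsCoherentFunctor M] [IsCoherentFunctor N], ElementaryEquivalent M N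

/-- The joint embedding property of a category: any two objects have morphisms to a common
object. -/
def JointEmbeddingProperty (K : Type u₃) [Category.{v₃} K] : Prop :=
  ∀ M N : K, ∃ P : K, Nonempty (M ⟶ P) ∧ Nonempty (N ⟶ P)

end CohLogic

open Filter

namespace CohLogic

/-! ### Subobjects and coherent functors in the category of types -/

section TypeValued

/-! Part (1) is a compactness argument: any two models `M`, `N` embed in one ultrapower of `N`, with
`N` embedding diagonally. For `M`, the index set consists of all families of functions `M x → N x`.
An ultrafilter makes almost every family natural along each given arrow and makes it avoid each
subobject that a given element avoids; evaluation is then elementary. Finitely many conditions are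
compatible because they reduce to a single one: some `m : M x`, from which all the elements involved
arise, avoids one subobject `c` of `x`. By elementary equivalence some `n : N x` avoids `c` as well
(`exists_notMem_extent`).

Part (2): an elementary map always reflects inclusions of subobjects. If complements exist it also
preserves them, so two models that embed in a third are elementary equivalent. -/

theorem range_mk_arrow {A X : Type u} (f : A ⟶ X) [Mono f] :
    Set.range (Subobject.mk f).arrow = Set.range f := by
  refine Set.Subset.antisymm ?_ ?_
  · rintro _ ⟨t, rfl⟩
    exact ⟨(Subobject.underlyingIso f).hom t,
      ConcreteCategory.congr_hom (Subobject.underlyingIso_hom_comp_eq_mk f) t⟩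
  · rintro _ ⟨t, rfl⟩
    exact ⟨(Subobject.underlyingIso f).inv t,
      ConcreteCategory.congr_hom (Subobject.underlyingIso_arrow f) t⟩

/-- Subobjects of a type correspond to its subsets, via the ranges of their inclusions. -/
noncomputable def subobjectOrderIsoSet (X : Type u) : Subobject X ≃o Set X where
  toFun S := Set.range S.arrow
  invFun s :=
    have : Mono (↾(Subtype.val : s → X)) := subtype_val_mono s
    Subobject.mk (↾(Subtype.val : s → X))
  left_inv S := by
    have := subtype_val_mono (Set.range S.arrow)
    have hS := (mono_iff_injective S.arrow).1 inferInstance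
    refine Subobject.mk_eq_of_comm _ (Equiv.ofInjective _ hS).symm.toIso ?_
    ext t
    exact Equiv.apply_ofInjective_symm hS t
  right_inv s := by
    have := subtype_val_mono s
    exact (range_mk_arrow _).trans Subtype.range_val
  map_rel_iff' {S T} := by
    refine ⟨fun h => ?_, ?_⟩
    · choose g hg using fun t => h ⟨t, rfl⟩
      exact Subobject.le_of_comm (↾g) (by ext t; exact hg t)
    · rintro h _ ⟨t, rfl⟩
      exact ⟨Subobject.ofLE S T h t, ConcreteCategory.congr_hom (Subobject.ofLE_arrow h) t⟩

theorem subobjectOrderIsoSet_mk {A X : Type u} (f : A ⟶ X) [Mono f] :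
    subobjectOrderIsoSet X (Subobject.mk f) = Set.range f :=
  range_mk_arrow f

variable {C : Type u} [SmallCategory C]

/-- The subset of `M x` given by a subobject of `x`. -/
def extent (M : C ⥤ Type u) {x : C} (a : Subobject x) : Set (M.obj x) :=
  Set.range (M.map a.arrow)

theorem extent_mono (M : C ⥤ Type u) {x : C} {a b : Subobject x} (h : a ≤ b) :
    extent M a ⊆ extent M b := by
  rintro _ ⟨t, rfl⟩
  refine ⟨M.map (Subobject.ofLE a b h) t, ?_⟩
  rw [← Functor.map_comp_apply, Subobject.ofLE_arrow]

theorem extent_mk (M : C ⥤ Type u) {a x : C} (i : a ⟶ x) [Mono i] :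
    extent M (Subobject.mk i) = Set.range (M.map i) := by
  refine Set.Subset.antisymm ?_ ?_
  · rintro _ ⟨t, rfl⟩
    refine ⟨M.map (Subobject.underlyingIso i).hom t, ?_⟩
    rw [← Functor.map_comp_apply, Subobject.underlyingIso_hom_comp_eq_mk]
  · rintro _ ⟨t, rfl⟩
    refine ⟨M.map (Subobject.underlyingIso i).inv t, ?_⟩
    rw [← Functor.map_comp_apply, Subobject.underlyingIso_arrow]

theorem extent_top (M : C ⥤ Type u) (x : C) :
    extent M (⊤ : Subobject x) = Set.univ := by
  refine Set.eq_univ_of_forall fun t => ⟨M.map (inv (⊤ : Subobject x).arrow) t, ?_⟩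
  rw [← Functor.map_comp_apply]
  simp

section

variable (M : C ⥤ Type u) [PreservesFiniteLimits M]

theorem subobjectOrderIsoSet_mapSub {x : C} (a : Subobject x) :
    subobjectOrderIsoSet _ (mapSub M a) = extent M a :=
  subobjectOrderIsoSet_mk _

theorem mapSub_le_mapSub_iff {x : C} {a b : Subobject x} :
    mapSub M a ≤ mapSub M b ↔ extent M a ⊆ extent M b := by
  rw [← (subobjectOrderIsoSet _).le_iff_le, subobjectOrderIsoSet_mapSub, subobjectOrderIsoSet_mapSub]

theorem isBot_mapSub_iff {x : C} {a : Subobject x} :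
    IsBot (mapSub M a) ↔ extent M a = ∅ := by
  rw [← subobjectOrderIsoSet_mapSub, ← Set.bot_eq_empty, ← isBot_iff_eq_bot]
  constructor
  · intro h t
    rw [← OrderIso.le_symm_apply]
    exact h _
  · intro h t
    rw [← (subobjectOrderIsoSet _).le_iff_le]
    exact h _

theorem isLUB_mapSub_iff {x : C} {a b c : Subobject x} :
    IsLUB {mapSub M a, mapSub M b} (mapSub M c) ↔ extent M c = extent M a ∪ extent M b := by
  rw [← (subobjectOrderIsoSet _).isLUB_image', Set.image_pair]
  simp only [subobjectOrderIsoSet_mapSub]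
  exact ⟨fun h => h.unique isLUB_pair, fun h => h ▸ isLUB_pair⟩

theorem extent_pullback {x y : C} [HasPullbacks C] (f : x ⟶ y) (a : Subobject y) :
    extent M ((Subobject.pullback f).obj a) = M.map f ⁻¹' extent M a := by
  have h := (Subobject.isPullback f a).map M
  ext t
  constructor
  · rintro ⟨s, rfl⟩
    exact ⟨_, ConcreteCategory.congr_hom h.w s⟩
  · rintro ⟨s, hs⟩
    obtain ⟨r, -, hr⟩ := Types.exists_of_isPullback h s t hs
    exact ⟨r, hr⟩

theorem extent_inf {x : C} [HasPullbacks C] (a b : Subobject x) :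
    extent M (a ⊓ b) = extent M a ∩ extent M b := by
  refine Set.Subset.antisymm
    (Set.subset_inter (extent_mono M inf_le_left) (extent_mono M inf_le_right)) ?_
  rintro _ ⟨⟨s, rfl⟩, t, ht⟩
  obtain ⟨r, rfl, -⟩ := Types.exists_of_isPullback ((Subobject.inf_isPullback a b).map M) s t ht.symm
  refine ⟨r, ?_⟩
  rw [← Functor.map_comp_apply, Subobject.ofLE_arrow]

end

theorem IsCoherentFunctor.surjective_map (M : C ⥤ Type u) [IsCoherentFunctor M] {x y : C}
    (f : x ⟶ y) (hf : IsRegularEpi f) : Function.Surjective (M.map f) := by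
  have := IsCoherentFunctor.isRegularEpi_map (M := M) f hf
  exact (epi_iff_surjective _).1 inferInstance

theorem extent_eq_empty (M : C ⥤ Type u) [IsCoherentFunctor M] {x : C} {b : Subobject x}
    (h : IsBot b) : extent M b = ∅ :=
  (isBot_mapSub_iff M).1 (IsCoherentFunctor.isBot_mapSub h)

theorem extent_eq_union (M : C ⥤ Type u) [IsCoherentFunctor M] {x : C} {a b c : Subobject x}
    (h : IsLUB {a, b} c) : extent M c = extent M a ∪ extent M b :=
  (isLUB_mapSub_iff M).1 (IsCoherentFunctor.isLUB_mapSub h)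

/-- A limit-preserving functor to types is coherent if it preserves surjections and finite unions
of subsets. -/
theorem IsCoherentFunctor.of_extent (M : C ⥤ Type u) [PreservesFiniteLimits M]
    (hsurj : ∀ {x y : C} (f : x ⟶ y), IsRegularEpi f → Function.Surjective (M.map f))
    (hbot : ∀ {x : C} {b : Subobject x}, IsBot b → extent M b = ∅)
    (hsup : ∀ {x : C} {a b c : Subobject x}, IsLUB {a, b} c →
      extent M c ⊆ extent M a ∪ extent M b) : IsCoherentFunctor M where
  isRegularEpi_map f hf := by
    have := (epi_iff_surjective _).2 (hsurj f hf)
    exact ⟨⟨regularEpiOfEpi _⟩⟩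
  isBot_mapSub h := (isBot_mapSub_iff M).2 (hbot h)
  isLUB_mapSub h := (isLUB_mapSub_iff M).2 ((hsup h).antisymm (Set.union_subset
    (extent_mono M (h.1 (by simp))) (extent_mono M (h.1 (by simp)))))

/-- A natural transformation of limit-preserving type-valued functors is elementary if it reflects
membership in subobjects. -/
theorem IsElementary.of_reflects {M N : C ⥤ Type u} [PreservesFiniteLimits M]
    [PreservesFiniteLimits N] (η : M ⟶ N)
    (h : ∀ ⦃a x : C⦄ (i : a ⟶ x) [Mono i] (m : M.obj x),
      η.app x m ∈ Set.range (N.map i) → m ∈ Set.range (M.map i)) : IsElementary η := by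
  intro a x i _
  have hM := (mono_iff_injective (M.map i)).1 inferInstance
  have hN := (mono_iff_injective (N.map i)).1 inferInstance
  rw [Types.isPullback_iff]
  refine ⟨η.naturality i, fun s t hst => hM hst.1, fun m p hp => ?_⟩
  obtain ⟨s, rfl⟩ := h i m ⟨p, hp.symm⟩
  refine ⟨s, rfl, hN ?_⟩
  rw [← hp]
  exact (ConcreteCategory.congr_hom (η.naturality i) s).symm

theorem IsElementary.mem_extent_iff {M N : C ⥤ Type u} {η : M ⟶ N} (hη : IsElementary η) {x : C}
    (a : Subobject x) (m : M.obj x) : η.app x m ∈ extent N a ↔ m ∈ extent M a := by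
  constructor
  · rintro ⟨p, hp⟩
    obtain ⟨s, hs, -⟩ := Types.exists_of_isPullback (hη a.arrow) m p hp.symm
    exact ⟨s, hs⟩
  · rintro ⟨s, rfl⟩
    exact ⟨η.app _ s, (ConcreteCategory.congr_hom (η.naturality a.arrow) s).symm⟩

/-- Elementary equivalence is applied to the inclusion `⊤ ≤ b`, which fails in a model exactly when
some element avoids `b`. -/
theorem ElementaryEquivalent.exists_notMem_extent {M N : C ⥤ Type u}
    [IsCoherentFunctor M] [IsCoherentFunctor N] (h : ElementaryEquivalent M N) {x : C}
    {b : Subobject x} {m : M.obj x} (hm : m ∉ extent M b) : ∃ n : N.obj x, n ∉ extent N b := by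
  have := (h ⊤ b).not
  rw [mapSub_le_mapSub_iff, mapSub_le_mapSub_iff, extent_top, extent_top, Set.univ_subset_iff,
    Set.univ_subset_iff, Set.eq_univ_iff_forall, Set.eq_univ_iff_forall] at this
  simpa using this.1 fun H => hm (H m)

end TypeValued

/-! ### Ultrapowers of coherent functors -/

section Ultrapower

variable {I : Type u}

/-- The functor sending a type `X` to the type of germs of functions `I → X` along a filter. -/
def germFunctor (l : Filter I) : Type u ⥤ Type u where
  obj X := Germ l X
  map f := ↾(Germ.map f)
  map_id X := by ext t; exact congrFun (Germ.map_id (l := l)) t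
  map_comp f g := by ext t; exact (Germ.map_map (l := l) g f t).symm

/-- The fragment of Łoś's theorem that suffices here, since surjectivity, emptiness, unions and
elementarity are all statements about ranges. -/
theorem mem_range_germFunctor_map_iff (l : Filter I) [l.NeBot] {X Y : Type u} (f : X ⟶ Y)
    (t : I → Y) :
    (t : Germ l Y) ∈ Set.range ((germFunctor l).map f) ↔ ∀ᶠ i in l, t i ∈ Set.range f := by
  constructor
  · rintro ⟨s, hs⟩
    induction s using Germ.inductionOn with | _ s =>
    filter_upwards [Germ.coe_eq.1 hs] with i hi using ⟨s i, hi⟩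
  · intro h
    -- Preimages are chosen at every index, so exceptional indices need a default value in `X`.
    obtain ⟨-, x, -⟩ := h.exists
    have : Nonempty X := ⟨x⟩
    choose! s hs using fun y (hy : y ∈ Set.range f) => hy
    exact ⟨((fun i => s (t i) : I → X) : Germ l X), Germ.coe_eq.2 (h.mono fun i hi => hs _ hi)⟩

instance (l : Filter I) [l.NeBot] : PreservesFiniteLimits (germFunctor l) := by
  have : PreservesLimit (Functor.empty.{0} (Type u)) (germFunctor l) := by
    refine preservesTerminal_of_iso _ (IsTerminal.uniqueUpToIso ?_ terminalIsTerminal)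
    have : Unique (⊤_ (Type u)) := Types.isTerminalEquivUnique _ terminalIsTerminal
    refine (Types.isTerminalEquivUnique _).symm ⟨⟨((fun _ => default : I → ⊤_ (Type u)) : Germ l _)⟩,
      fun t => ?_⟩
    induction t using Germ.inductionOn with | _ t =>
    exact congrArg _ (Subsingleton.elim _ _)
  have := preservesLimitsOfShape_pempty_of_preservesTerminal (germFunctor l)
  have : PreservesLimitsOfShape WalkingCospan (germFunctor l) := by
    refine preservesLimitsOfShape_walkingCospan_of_forall_isPullback fun X Y Z f g _ => ?_
    refine ⟨_, _, _, IsPullback.of_hasPullback f g, ?_⟩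
    have h := IsPullback.of_hasPullback f g
    rw [Types.isPullback_iff]
    refine ⟨by rw [← Functor.map_comp, h.w, Functor.map_comp], fun s t => ?_, fun s t => ?_⟩
    · induction s using Germ.inductionOn with | _ s =>
      induction t using Germ.inductionOn with | _ t =>
      rintro ⟨h₁, h₂⟩
      refine Germ.coe_eq.2 ?_
      filter_upwards [Germ.coe_eq.1 h₁, Germ.coe_eq.1 h₂] with i h₁ h₂
      exact Types.ext_of_isPullback h h₁ h₂
    · induction s using Germ.inductionOn with | _ s =>
      induction t using Germ.inductionOn with | _ t =>
      intro hst
      have hst := Germ.coe_eq.1 hst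
      have key : ∀ᶠ i in l, ∃ r, pullback.fst f g r = s i ∧ pullback.snd f g r = t i :=
        hst.mono fun i hi => Types.exists_of_isPullback h _ _ hi
      obtain ⟨-, r₀, -⟩ := key.exists
      have : Nonempty ↑(pullback f g) := ⟨r₀⟩
      obtain ⟨r, hr⟩ := key.choice
      exact ⟨(r : Germ l _), Germ.coe_eq.2 (hr.mono fun i hi => hi.1),
        Germ.coe_eq.2 (hr.mono fun i hi => hi.2)⟩
  exact preservesFiniteLimits_of_preservesTerminal_and_pullbacks _

variable {C : Type u} [SmallCategory C]

/-- Ultrapowers of coherent functors are coherent. -/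
theorem isCoherentFunctor_comp_germFunctor (N : C ⥤ Type u) [IsCoherentFunctor N]
    (U : Ultrafilter I) : IsCoherentFunctor (N ⋙ germFunctor (U : Filter I)) := by
  have : PreservesFiniteLimits (N ⋙ germFunctor (U : Filter I)) := comp_preservesFiniteLimits _ _
  refine .of_extent _ (fun f hf t => ?_) (fun {x b} hb => ?_) (fun {x a b c} hc t => ?_)
  · induction t using Germ.inductionOn with | _ t =>
    exact (mem_range_germFunctor_map_iff _ _ _).2
      (.of_forall fun i => IsCoherentFunctor.surjective_map N f hf _)
  · refine Set.eq_empty_of_forall_notMem fun t ht => ?_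
    induction t using Germ.inductionOn with | _ t =>
    obtain ⟨i, hi⟩ := ((mem_range_germFunctor_map_iff _ _ _).1 ht).exists
    exact (extent_eq_empty N hb).subset hi
  · induction t using Germ.inductionOn with | _ t =>
    intro ht
    have h := (mem_range_germFunctor_map_iff _ _ _).1 ht
    have h' : ∀ᶠ i in (U : Filter I), t i ∈ extent N a ∨ t i ∈ extent N b :=
      h.mono fun i hi => (extent_eq_union N hc).subset hi
    -- Unions are where a proper filter is not enough: an ultrafilter decides which disjunct holds
    -- almost everywhere.
    exact (Ultrafilter.eventually_or.1 h').imp (mem_range_germFunctor_map_iff _ _ _).2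
      (mem_range_germFunctor_map_iff _ _ _).2

/-- The diagonal embedding of a functor into its ultrapower. -/
def diagonal (l : Filter I) (N : C ⥤ Type u) : N ⟶ N ⋙ germFunctor l where
  app x := ↾fun n => ((fun _ => n : I → N.obj x) : Germ l (N.obj x))

theorem isElementary_diagonal (l : Filter I) [l.NeBot] (N : C ⥤ Type u)
    [PreservesFiniteLimits N] : IsElementary (diagonal l N) := by
  have : PreservesFiniteLimits (N ⋙ germFunctor l) := comp_preservesFiniteLimits _ _
  refine .of_reflects _ fun a x i _ n hn => ?_
  exact ((mem_range_germFunctor_map_iff l (N.map i) _).1 hn).exists.choose_spec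

end Ultrapower

/-! ### Compactness and the joint embedding property -/

section JointEmbedding

variable {C : Type u} [SmallCategory C] [CoherentCategory C]

/-- Every finite family of subobjects has an upper bound that coherent functors send into the union. -/
theorem exists_finite_union {x : C} {ι : Type*} (s : Finset ι) (b : ι → Subobject x) :
    ∃ c : Subobject x, (∀ i ∈ s, b i ≤ c) ∧ ∀ (M : C ⥤ Type u) [IsCoherentFunctor M],
      extent M c ⊆ ⋃ i ∈ s, extent M (b i) := by
  classical
  induction s using Finset.induction_on with
  | empty =>
    obtain ⟨c, hc⟩ := CoherentCategory.exists_isBot x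
    exact ⟨c, by simp, fun M _ => by simp [extent_eq_empty M hc]⟩
  | insert i s _ ih =>
    obtain ⟨c, hc, hM⟩ := ih
    obtain ⟨d, hd⟩ := CoherentCategory.exists_isLUB (b i) c
    refine ⟨d, ?_, fun M _ => ?_⟩
    · intro j hj
      obtain rfl | hj := Finset.mem_insert.1 hj
      · exact hd.1 (by simp)
      · exact (hc j hj).trans (hd.1 (by simp))
    · rw [extent_eq_union M hd, Finset.set_biUnion_insert]
      exact Set.union_subset_union_right _ (hM M)

/-- The conditions on a family of functions `M x → N x`, each of which is satisfied almost
everywhere in the construction of an elementary map from `M` to an ultrapower of `N`: naturality,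
and reflection of a subobject at an element outside of it. -/
abbrev DiagramCondition (M : C ⥤ Type u) : Type u :=
  (Σ p q : M.Elements, p ⟶ q) ⊕ Σ p : M.Elements, {b : Subobject p.1 // p.2 ∉ extent M b}

/-- The families of functions satisfying a condition. -/
def DiagramCondition.solutions {M : C ⥤ Type u} (N : C ⥤ Type u) :
    DiagramCondition M → Set (∀ x, M.obj x → N.obj x)
  | .inl ⟨p, q, f⟩ => {φ | φ q.1 q.2 = N.map f.1 (φ p.1 p.2)}
  | .inr ⟨p, b⟩ => {φ | φ p.1 p.2 ∉ extent N b.1}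

open Classical in
/-- The elements involved in a condition. -/
noncomputable def DiagramCondition.support {M : C ⥤ Type u} :
    DiagramCondition M → Finset M.Elements
  | .inl ⟨p, q, _⟩ => {p, q}
  | .inr ⟨p, _⟩ => {p}

variable {M N : C ⥤ Type u} [IsCoherentFunctor M] [IsCoherentFunctor N]

theorem ElementaryEquivalent.nonempty (h : ElementaryEquivalent M N) {x : C} (m : M.obj x) :
    Nonempty (N.obj x) := by
  obtain ⟨b, hb⟩ := CoherentCategory.exists_isBot x
  obtain ⟨n, -⟩ := h.exists_notMem_extent (b := b) (m := m) (by simp [extent_eq_empty M hb])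
  exact ⟨n⟩

/-- Finitely many conditions are simultaneously satisfiable. -/
theorem ElementaryEquivalent.nonempty_iInter_solutions (h : ElementaryEquivalent M N)
    (t : Finset (DiagramCondition M)) : (⋂ k ∈ t, k.solutions N).Nonempty := by
  classical
  -- `M` preserves finite limits, so its category of elements has them and is cofiltered.
  have : HasFiniteLimits M.Elements := ⟨fun J _ _ => inferInstance⟩
  have : IsCofiltered M.Elements := IsCofiltered.of_hasFiniteLimits _
  let O : Finset M.Elements := t.biUnion DiagramCondition.support
  have hO {k} (hk : k ∈ t) {p} (hp : p ∈ k.support) : p ∈ O := Finset.mem_biUnion.2 ⟨k, hk, hp⟩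
  let H : Finset ((p : M.Elements) ×' (q : M.Elements) ×' (_ : p ∈ O) ×' (_ : q ∈ O) ×' (p ⟶ q)) :=
    t.attach.biUnion fun
      | ⟨.inl ⟨p, q, f⟩, hk⟩ =>
        {⟨p, q, hO hk (by simp [DiagramCondition.support]),
          hO hk (by simp [DiagramCondition.support]), f⟩}
      | ⟨.inr _, _⟩ => ∅
  -- `S` maps to every element involved, compatibly with the arrows of the naturality conditions.
  obtain ⟨S, T, hT⟩ := IsCofiltered.inf_exists O H
  -- Each subobject to be avoided is pulled back to `S`; naturality conditions contribute the bottom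
  -- subobject, which excludes nothing.
  let B : DiagramCondition M → Subobject S.1
    | .inl _ => (CoherentCategory.exists_isBot S.1).choose
    | .inr ⟨p, b⟩ => if hp : p ∈ O then (Subobject.pullback (T hp).1).obj b.1
        else (CoherentCategory.exists_isBot S.1).choose
  have hB : ∀ k, S.2 ∉ extent M (B k) := by
    have h₀ : S.2 ∉ extent M (CoherentCategory.exists_isBot S.1).choose := by
      rw [extent_eq_empty M (CoherentCategory.exists_isBot S.1).choose_spec]
      exact Set.notMem_empty _
    rintro (_ | ⟨p, b, hb⟩)
    · exact h₀
    · by_cases hp : p ∈ O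
      · simpa [B, hp, extent_pullback, (T hp).2] using hb
      · simpa [B, hp] using h₀
  obtain ⟨c, hc, hcM⟩ := exists_finite_union t B
  obtain ⟨n, hn⟩ := h.exists_notMem_extent (b := c) (m := S.2) fun hS => by
    obtain ⟨k, -, hk⟩ := Set.mem_iUnion₂.1 (hcM M hS)
    exact hB k hk
  -- The values on `O` are transported from `n`, which gives naturality; values elsewhere are
  -- arbitrary.
  let φ (x : C) (m : M.obj x) : N.obj x :=
    if hp : M.elementsMk x m ∈ O then N.map (T hp).1 n else (h.nonempty m).some
  have hφ {p : M.Elements} (hp : p ∈ O) : φ p.1 p.2 = N.map (T hp).1 n := dif_pos hp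
  refine ⟨φ, Set.mem_iInter₂.2 ?_⟩
  rintro (⟨p, q, f⟩ | ⟨p, b, hb⟩) hk
  · have hp := hO hk (p := p) (by simp [DiagramCondition.support])
    have hq := hO hk (p := q) (by simp [DiagramCondition.support])
    have := hT hp hq (f := f) (Finset.mem_biUnion.2 ⟨⟨_, hk⟩, Finset.mem_attach _ _, by simp⟩)
    change φ q.1 q.2 = N.map f.1 (φ p.1 p.2)
    rw [hφ hp, hφ hq, ← this, CategoryOfElements.comp_val, Functor.map_comp_apply]
  · have hp := hO hk (p := p) (by simp [DiagramCondition.support])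
    change φ p.1 p.2 ∉ extent N b
    rw [hφ hp]
    intro hmem
    refine hn (extent_mono N (hc _ hk) ?_)
    simpa [B, hp, extent_pullback] using hmem

/-- If `M` and `N` are elementary equivalent, then `M` embeds elementarily into an ultrapower
of `N`. -/
theorem ElementaryEquivalent.exists_ultrapower (h : ElementaryEquivalent M N) :
    ∃ (I : Type u) (U : Ultrafilter I) (η : M ⟶ N ⋙ germFunctor (U : Filter I)),
      IsElementary η := by
  let F : Filter (∀ x, M.obj x → N.obj x) := ⨅ k : DiagramCondition M, 𝓟 (k.solutions N)
  have : F.NeBot := (hasBasis_iInf_principal_finite _).neBot_iff.2 fun {t} ht => by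
    simpa using h.nonempty_iInter_solutions ht.toFinset
  let U := Ultrafilter.of F
  have hU (k : DiagramCondition M) : ∀ᶠ φ in (U : Filter _), φ ∈ k.solutions N :=
    Ultrafilter.of_le F (mem_iInf_of_mem k (mem_principal_self _))
  let η : M ⟶ N ⋙ germFunctor (U : Filter _) :=
    { app x := ↾fun m => Germ.ofFun fun φ : ∀ x, M.obj x → N.obj x => φ x m
      naturality x y f := by
        ext m
        exact Germ.coe_eq.2 (hU (.inl ⟨M.elementsMk x m, M.elementsMk y (M.map f m), f, rfl⟩)) }
  have : PreservesFiniteLimits (N ⋙ germFunctor (U : Filter (∀ x, M.obj x → N.obj x))) :=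
    comp_preservesFiniteLimits _ _
  refine ⟨_, U, η, .of_reflects _ fun a x i _ m hm => ?_⟩
  by_contra hm'
  rw [← extent_mk] at hm'
  obtain ⟨φ, hφ, hφ'⟩ := (((mem_range_germFunctor_map_iff _ (N.map i) _).1 hm).and
    (hU (.inr ⟨M.elementsMk x m, Subobject.mk i, hm'⟩))).exists
  rw [← extent_mk] at hφ
  exact hφ' hφ

end JointEmbedding

/-! ### Elementary maps out of models of Boolean categories -/

section Boolean

variable {C : Type u} [SmallCategory C] [CoherentCategory C]
  {M P : C ⥤ Type u} [IsCoherentFunctor M] [IsCoherentFunctor P] {η : M ⟶ P}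

/-- The image of `a` in the terminal object has a complement `c`. If `M a` is empty, the point of `M
1` lies in `c`, hence so does the point of `P 1`, and this excludes elements of `P a`. -/
theorem IsElementary.isEmpty (hC : IsBoolean C) (hη : IsElementary η) {a : C}
    (ha : IsEmpty (M.obj a)) : IsEmpty (P.obj a) := by
  let F := Regular.strongEpiMonoFactorisation (terminal.from a)
  have hsurj (K : C ⥤ Type u) [IsCoherentFunctor K] : Function.Surjective (K.map F.e) :=
    IsCoherentFunctor.surjective_map K _ inferInstance
  obtain ⟨c, hbot, htop⟩ := hC _ (Subobject.mk F.m)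
  have hM : extent M (Subobject.mk F.m) = ∅ := by
    refine Set.eq_empty_of_forall_notMem ?_
    rintro _ ⟨t, -⟩
    obtain ⟨s, -⟩ := hsurj M (M.map (Subobject.underlyingIso F.m).hom t)
    exact ha.elim s
  let m : M.obj (⊤_ C) :=
    (Types.isTerminalEquivUnique _ (terminalIsTerminal.isTerminalObj M _)).default
  have hm : m ∈ extent M c := by
    have : m ∈ extent M (⊤ : Subobject (⊤_ C)) := by rw [extent_top]; trivial
    rwa [extent_eq_union M htop, hM, Set.empty_union] at this
  refine ⟨fun t => ?_⟩
  have := Types.isTerminalEquivUnique _ (terminalIsTerminal.isTerminalObj P _)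
  have hP : η.app _ m ∈ extent P (Subobject.mk F.m ⊓ c) := by
    rw [extent_inf]
    refine ⟨⟨P.map (F.e ≫ (Subobject.underlyingIso F.m).inv) t, Subsingleton.elim _ _⟩,
      (hη.mem_extent_iff c m).2 hm⟩
  rwa [extent_eq_empty P hbot] at hP

/-- With `c` a complement of `b`, inclusion of `a` in `b` amounts to emptiness of `a ⊓ c`, which
passes from `M` to `P` by `IsElementary.isEmpty`. The converse uses only elementarity. -/
theorem IsElementary.extent_subset_iff (hC : IsBoolean C) (hη : IsElementary η) {x : C}
    (a b : Subobject x) : extent M a ⊆ extent M b ↔ extent P a ⊆ extent P b := by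
  refine ⟨fun h t ht => ?_,
    fun h m hm => (hη.mem_extent_iff b m).1 (h ((hη.mem_extent_iff a m).2 hm))⟩
  obtain ⟨c, hbot, htop⟩ := hC x b
  have hM : IsEmpty (M.obj ((a ⊓ c : Subobject x) : C)) := by
    refine ⟨fun s => ?_⟩
    have hs : M.map (a ⊓ c).arrow s ∈ extent M (a ⊓ c) := ⟨s, rfl⟩
    rw [extent_inf] at hs
    have : M.map (a ⊓ c).arrow s ∈ extent M (b ⊓ c) := by
      rw [extent_inf]
      exact ⟨h hs.1, hs.2⟩
    rwa [extent_eq_empty M hbot] at this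
  have hP := hη.isEmpty hC hM
  have ht' : t ∈ extent P (⊤ : Subobject x) := by rw [extent_top]; trivial
  rw [extent_eq_union P htop] at ht'
  refine ht'.resolve_right fun htc => ?_
  have : t ∈ extent P (a ⊓ c) := by
    rw [extent_inf]
    exact ⟨ht, htc⟩
  exact hP.elim this.choose

end Boolean

end CohLogic

theorem mainTheorem8 (C : Type u) [SmallCategory C] [CohLogic.CoherentCategory C] :
    (CohLogic.SemanticallyComplete C →
      CohLogic.JointEmbeddingProperty (CohLogic.CohE C (Type u))) ∧
    (CohLogic.IsBoolean C → ¬ CohLogic.IsTrivialCategory C →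
      CohLogic.JointEmbeddingProperty (CohLogic.CohE C (Type u)) →
        CohLogic.SemanticallyComplete C) := by
  refine ⟨fun ⟨_, h⟩ M N => ?_, fun hC hne hJ => ⟨hne, fun M N _ _ x a b => ?_⟩⟩
  · obtain ⟨I, U, η, hη⟩ := (h M.functor N.functor).exists_ultrapower
    have := CohLogic.isCoherentFunctor_comp_germFunctor N.functor U
    exact ⟨⟨N.functor ⋙ CohLogic.germFunctor (U : Filter I)⟩, ⟨⟨η, hη⟩⟩,
      ⟨⟨CohLogic.diagonal _ _, CohLogic.isElementary_diagonal _ _⟩⟩⟩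
  · obtain ⟨P, ⟨η, hη⟩, ⟨θ, hθ⟩⟩ := hJ ⟨M⟩ ⟨N⟩
    rw [CohLogic.mapSub_le_mapSub_iff, CohLogic.mapSub_le_mapSub_iff]
    exact (hη.extent_subset_iff hC a b).trans (hθ.extent_subset_iff hC a b).symm
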